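/- Let $d \ge 3$ be fixed. For $n \ge 1$ consider the $d$-dimensional grid $(\mathbb{Z}/n\mathbb{Z})^d$ with periodic boundary conditions, which has $N = n^d$ vertices, and the space $\mathbb{C}^{2d} \otimes \mathbb{C}^{N}$ spanned by $|i_\pm\rangle \otimes |x\rangle$, with $1 \le i \le d$ and $x \in (\mathbb{Z}/n\mathbb{Z})^d$. Let $S$ be the flip-flop shift $S\,|i_\pm\rangle \otimes |x\rangle = |i_\mp\rangle \otimes |x \pm e_i\rangle$. Let $|s\rangle = \frac{1}{\sqrt{2d}} \sum_{i,\pm} |i_\pm\rangle$ and $C_0 = 2|s\rangle\langle s| - I$. For a marked vertex $v$ let $U'_v = S\,\bigl(C_0 \otimes (I - |v\rangle\langle v|) - I \otimes |v\rangle\langle v|\bigr)$ be the perturbed quantum walk, and let $|\Phi_0\rangle$ be the uniform superposition of all $2dN$ basis states. Then there are constants $C, p > 0$ depending only on $d$ such that for every $n \ge 1$ there is an integer $T \ge 0$ with $T \le C\sqrt{N}$ such that, for every vertex $v$, measuring the position register of $(U'_v)^T |\Phi_0\rangle$ gives the marked vertex $v$ with probability at least $p$. Moreover, for $k \in \{0,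 \ldots, n-1\}^d$ let $\theta_k \in [0, \pi]$ be defined by $\cos\theta_k = \frac{1}{d} \sum_{i=1}^d \cos\frac{2\pi k_i}{n}$. Then there are constants $a, b > 0$ depending only on $d$ such that, for all $n \ge 2$, $$a N \;\le\; \sum_{k \ne 0} \frac{1}{1 - \cos\theta_k} \;\le\; b N .$$ -/

import Mathlib

open scoped Matrix Kronecker

noncomputable section

namespace GridSearch

/-- Vertices of the `d`-dimensional periodic grid of side length `n`; there are `n ^ d` of them. -/
abbrev Vertex (d n : ℕ) : Type := Fin d → ZMod n

/-- The `2 * d` directions: `(i, true)` is the positive and `(i, false)` the negative direction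
along the `i`-th axis. They index the basis of the coin space. -/
abbrev Direction (d : ℕ) : Type := Fin d × Bool

/-- Basis labels of the joint space of coin and position, `|direction⟩ ⊗ |vertex⟩`. -/
abbrev Label (d n : ℕ) : Type := Direction d × Vertex d n

/-- The neighbour of `x` in a given direction (periodic boundary conditions). -/
def neighbor {d n : ℕ} (e : Direction d) (x : Vertex d n) : Vertex d n :=
  if e.2 then x + Pi.single e.1 1 else x - Pi.single e.1 1

/-- The action of the flip-flop shift on labels: move along the direction, then reverse it. -/
def flipFlop {d n : ℕ} (b : Label d n) : Label d n :=
  ((b.1.1, !b.1.2), neighbor b.1 b.2)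

/-- The flip-flop shift operator `S`, which sends the basis state `b` to `flipFlop b`. -/
def shift (d n : ℕ) : Matrix (Label d n) (Label d n) ℂ :=
  Matrix.of fun b' b => if b' = flipFlop b then 1 else 0

/-- The uniform coin state `|s⟩`. -/
def coinUniform (d : ℕ) : Direction d → ℂ := fun _ => 1 / (√(2 * d : ℝ) : ℂ)

/-- The coin flip `C₀ = 2 |s⟩⟨s| - I`. -/
def coinFlip (d : ℕ) : Matrix (Direction d) (Direction d) ℂ :=
  (2 : ℂ) • Matrix.vecMulVec (coinUniform d) (star (coinUniform d)) - 1

/-- The marking coin `C₁ = - I`. -/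
def markingCoin (d : ℕ) : Matrix (Direction d) (Direction d) ℂ := -1

/-- The projection `|v⟩⟨v|` on the position space. -/
def vertexProj {d n : ℕ} (v : Vertex d n) : Matrix (Vertex d n) (Vertex d n) ℂ :=
  Matrix.single v v 1

/-- The perturbed coin operator `C' = C₀ ⊗ (I - |v⟩⟨v|) + C₁ ⊗ |v⟩⟨v|`. -/
def perturbedCoin {d n : ℕ} (v : Vertex d n) : Matrix (Label d n) (Label d n) ℂ :=
  coinFlip d ⊗ₖ (1 - vertexProj v) + markingCoin d ⊗ₖ vertexProj v

/-- One step `U' = S C'` of the perturbed quantum walk with marked vertex `v`. -/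
def walkStep {d n : ℕ} [NeZero n] (v : Vertex d n) : Matrix (Label d n) (Label d n) ℂ :=
  shift d n * perturbedCoin v

/-- The uniform superposition `|Φ₀⟩` over all `2 d N` basis states, where `N = n ^ d`. -/
def initialState (d n : ℕ) : Label d n → ℂ := fun _ => 1 / (√(2 * d * (n : ℝ) ^ d) : ℂ)

/-- The state `(U') ^ T |Φ₀⟩` of the search algorithm after `T` steps. -/
def stateAfter {d n : ℕ} [NeZero n] (v : Vertex d n) (T : ℕ) : Label d n → ℂ :=
  (walkStep v ^ T) *ᵥ initialState d n

/-- The probability that measuring the position register after `T` steps gives the marked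
vertex `v`. -/
def successProb {d n : ℕ} [NeZero n] (v : Vertex d n) (T : ℕ) : ℝ :=
  ∑ e : Direction d, ‖stateAfter v T (e, v)‖ ^ 2

/-- The angle `θ_k ∈ [0, π]` of the Fourier mode `k`, with
`cos θ_k = (1 / d) ∑ i, cos (2 π k_i / n)`. -/
def modeAngle {d n : ℕ} (k : Fin d → ZMod n) : ℝ :=
  Real.arccos ((1 / (d : ℝ)) * ∑ i, Real.cos (2 * Real.pi * ((k i).val : ℝ) / (n : ℝ)))

end GridSearch

end

/-!
Write `L` for one step of the walk and `Φ` for the uniform state. For `0 < r < 1` the discounted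
sum `G = ∑ t, r ^ t L ^ t Φ` is explicit: it is read off from the solution of the resolvent
equation of the simple random walk killed at the marked vertex, and its amplitude there is governed
by the expected discounted time the random walk needs to return. When the walk has a Dirichlet gap
of order `1 / N`, taking `1 - r` of order `1 / √N` makes that amplitude so large that, `G` being a
discounted sum, some single state `L ^ t Φ` with `t = O(√N)` has amplitude of order one at the
marked vertex.

The gap follows from Cauchy–Schwarz in Fourier space: a function vanishing at `0` has Fourier
coefficients summing to zero, so `∑ 1 / (1 - cos θ_k) ≤ b N` controls its mode `0` by its energy.
For that sum, `1 - cos θ_k` is at least of order `‖k‖ ^ 2 / n ^ 2`, and the `O(m ^ (d - 1))` modes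
of sup norm `m` contribute `O(n ^ 2 m ^ (d - 3))`, which adds up to `O(n ^ d)` when `3 ≤ d`.
-/

namespace GridSearch

section Resolvent

variable {𝕜 E F : Type*} [NontriviallyNormedField 𝕜] [NormedAddCommGroup E] [NormedSpace 𝕜 E]
  [NormedAddCommGroup F] [NormedSpace 𝕜 F] {L : Module.End 𝕜 E} {r : 𝕜} {G φ : E}

lemma sum_smul_pow_apply (hG : G - r • L G = φ) (T : ℕ) :
    ∑ t ∈ Finset.range T, r ^ t • (L ^ t) φ = G - r ^ T • (L ^ T) G := by
  induction T with
  | zero => simp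
  | succ T ih =>
    rw [Finset.sum_range_succ, ih, ← hG, map_sub, map_smul, pow_succ L, Module.End.mul_apply,
      smul_sub, smul_smul, ← pow_succ]
    abel

lemma norm_pow_apply_le (hL : ∀ x, ‖L x‖ ≤ ‖x‖) (t : ℕ) (x : E) : ‖(L ^ t) x‖ ≤ ‖x‖ := by
  induction t with
  | zero => simp
  | succ t ih => exact pow_succ' L t ▸ (hL _).trans ih

lemma one_sub_norm_mul_norm_le (hL : ∀ x, ‖L x‖ ≤ ‖x‖) (hG : G - r • L G = φ) :
    (1 - ‖r‖) * ‖G‖ ≤ ‖φ‖ := by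
  have hLG : ‖r • L G‖ ≤ ‖r‖ * ‖G‖ := by
    rw [norm_smul]
    gcongr
    exact hL G
  calc (1 - ‖r‖) * ‖G‖ = ‖G‖ - ‖r‖ * ‖G‖ := by ring
    _ ≤ ‖G‖ - ‖r • L G‖ := by gcongr
    _ ≤ ‖φ‖ := hG ▸ norm_sub_norm_le _ _

lemma one_sub_norm_mul_norm_resolvent_le (hL : ∀ x, ‖L x‖ ≤ ‖x‖) (hr : ‖r‖ ≤ 1)
    (hG : G - r • L G = φ) (m : E →ₗ[𝕜] F) {B M : ℝ} (hM : 0 ≤ M) (hm : ∀ x, ‖m x‖ ≤ M * ‖x‖)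
    {T : ℕ} (hB : ∀ t < T, ‖m ((L ^ t) φ)‖ ≤ B) :
    (1 - ‖r‖) * ‖m G‖ ≤ (1 - ‖r‖ ^ T) * B + ‖r‖ ^ T * (M * ‖φ‖) := by
  have hsplit : m G = ∑ t ∈ Finset.range T, r ^ t • m ((L ^ t) φ) + r ^ T • m ((L ^ T) G) := by
    have := congrArg m (sum_smul_pow_apply hG T)
    simp only [map_sum, map_sub, map_smul] at this
    rw [this, sub_add_cancel]
  have hhead : ‖∑ t ∈ Finset.range T, r ^ t • m ((L ^ t) φ)‖ ≤
      ∑ t ∈ Finset.range T, ‖r‖ ^ t * B := by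
    refine norm_sum_le_of_le _ fun t ht => ?_
    rw [norm_smul, norm_pow]
    gcongr
    exact hB t (Finset.mem_range.1 ht)
  have htail : ‖r ^ T • m ((L ^ T) G)‖ ≤ ‖r‖ ^ T * (M * ‖G‖) := by
    rw [norm_smul, norm_pow]
    gcongr
    exact (hm _).trans (mul_le_mul_of_nonneg_left (norm_pow_apply_le hL T G) hM)
  have : 0 ≤ 1 - ‖r‖ := sub_nonneg.2 hr
  calc (1 - ‖r‖) * ‖m G‖
      ≤ (1 - ‖r‖) * (∑ t ∈ Finset.range T, ‖r‖ ^ t * B + ‖r‖ ^ T * (M * ‖G‖)) := by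
        rw [hsplit]
        gcongr
        exact norm_add_le_of_le hhead htail
    _ = (∑ t ∈ Finset.range T, ‖r‖ ^ t) * (1 - ‖r‖) * B
          + ‖r‖ ^ T * (M * ((1 - ‖r‖) * ‖G‖)) := by
        rw [← Finset.sum_mul]
        ring
    _ ≤ (1 - ‖r‖ ^ T) * B + ‖r‖ ^ T * (M * ‖φ‖) := by
        rw [geom_sum_mul_neg]
        gcongr
        exact one_sub_norm_mul_norm_le hL hG

end Resolvent

section DirichletGap

variable {V : Type*} [Fintype V]

/-- The Dirichlet spectral gap of an averaging operator `P` killed at `v` is at least `γ`, stated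
through the quadratic form of `1 - P` on functions that vanish at `v`. -/
def HasDirichletGap (P : Module.End ℝ (V → ℝ)) (v : V) (γ : ℝ) : Prop :=
  ∀ f : V → ℝ, f v = 0 → γ * ∑ x, f x ^ 2 ≤ ∑ x, f x * (f x - P f x)

variable {P : Module.End ℝ (V → ℝ)} {v : V} {γ ε : ℝ} {h : V → ℝ}

lemma HasDirichletGap.add_mul_sum_sq_le {u : V → ℝ} (hP : HasDirichletGap P v γ)
    (hv : h v = 0) (hh : ∀ x, x ≠ v → (1 + ε) * h x - P h x = u x) :
    (γ + ε) * ∑ x, h x ^ 2 ≤ ∑ x, h x * u x := by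
  have hpair : ∑ x, h x * (h x - P h x) + ε * ∑ x, h x ^ 2 = ∑ x, h x * u x := by
    rw [Finset.mul_sum, ← Finset.sum_add_distrib]
    refine Finset.sum_congr rfl fun x _ => ?_
    rcases eq_or_ne x v with rfl | hx
    · simp [hv]
    · rw [← hh x hx]
      ring
  linarith [hP h hv]

lemma HasDirichletGap.exists_killed_resolvent (hP : HasDirichletGap P v γ) (hγε : 0 < γ + ε)
    (u : V → ℝ) : ∃ h : V → ℝ, h v = 0 ∧ ∀ x, x ≠ v → (1 + ε) * h x - P h x = u x := by
  classical
  let A : Module.End ℝ (V → ℝ) := LinearMap.pi fun x =>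
    if x = v then LinearMap.proj v else LinearMap.proj x ∘ₗ ((1 + ε) • LinearMap.id - P)
  have hAv (f : V → ℝ) : A f v = f v := by simp [A]
  have hA (f : V → ℝ) {x : V} (hx : x ≠ v) : A f x = (1 + ε) * f x - P f x := by simp [A, hx]
  have hinj : Function.Injective A := by
    refine (injective_iff_map_eq_zero A).2 fun f hf => ?_
    have hle := hP.add_mul_sum_sq_le (h := f) (ε := ε) (u := 0)
      (by rw [← hAv f, hf, Pi.zero_apply]) fun x hx => by rw [← hA f hx, hf]
    have hsum : ∑ x, f x ^ 2 = 0 := by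
      refine le_antisymm (nonpos_of_mul_nonpos_right ?_ hγε) (by positivity)
      simpa using hle
    funext x
    simpa using (Finset.sum_eq_zero_iff_of_nonneg fun x _ => sq_nonneg (f x)).1 hsum x
  obtain ⟨h, hh⟩ := LinearMap.injective_iff_surjective.1 hinj fun x => if x = v then 0 else u x
  exact ⟨h, (hAv h).symm.trans (by simp [hh]),
    fun x hx => (hA h hx).symm.trans (by simp [hh, hx])⟩

lemma HasDirichletGap.sum_killed_resolvent_le (hP : HasDirichletGap P v γ) (hγε : 0 < γ + ε)
    (hv : h v = 0) (hh : ∀ x, x ≠ v → (1 + ε) * h x - P h x = 1) :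
    ∑ x, h x ≤ Fintype.card V / (γ + ε) := by
  have hsq : (γ + ε) * ∑ x, h x ^ 2 ≤ ∑ x, h x := by
    simpa using hP.add_mul_sum_sq_le (u := 1) hv hh
  have hCS : (∑ x, h x) ^ 2 ≤ Fintype.card V * ∑ x, h x ^ 2 := by
    simpa using sq_sum_le_card_mul_sum_sq (s := Finset.univ) (f := h)
  rw [le_div_iff₀ hγε]
  by_contra! hlt
  have hpos : 0 < ∑ x, h x := pos_of_mul_pos_left (lt_of_le_of_lt (by positivity) hlt) hγε.le
  nlinarith

/-- For `ε = 0` this is Kac's formula: `1 + P h v` is the mean return time to `v`. -/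
lemma one_add_killed_resolvent (hP : ∀ f : V → ℝ, ∑ x, P f x = ∑ x, f x)
    (hv : h v = 0) (hh : ∀ x, x ≠ v → (1 + ε) * h x - P h x = 1) :
    1 + P h v = Fintype.card V - ε * ∑ x, h x := by
  classical
  have hsum : ∑ x, (1 + P h x - (1 + ε) * h x) = 1 + P h v := by
    rw [Finset.sum_eq_single v (fun x _ hx => by linarith [hh x hx]) (by simp), hv]
    ring
  rw [← hsum, Finset.sum_sub_distrib, Finset.sum_add_distrib, hP, ← Finset.mul_sum]
  simp only [Finset.sum_const, Finset.card_univ, nsmul_eq_mul, mul_one]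
  ring

lemma HasDirichletGap.le_one_add_killed_resolvent (hP : HasDirichletGap P v γ)
    (hsum : ∀ f : V → ℝ, ∑ x, P f x = ∑ x, f x) (hε : 0 ≤ ε) (hγε : 0 < γ + ε) (hv : h v = 0)
    (hh : ∀ x, x ≠ v → (1 + ε) * h x - P h x = 1) :
    Fintype.card V * (γ / (γ + ε)) ≤ 1 + P h v :=
  calc Fintype.card V * (γ / (γ + ε))
      = Fintype.card V - ε * (Fintype.card V / (γ + ε)) := by
        field_simp
        ring
    _ ≤ Fintype.card V - ε * ∑ x, h x := by
        gcongr
        exact hP.sum_killed_resolvent_le hγε hv hh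
    _ = 1 + P h v := (one_add_killed_resolvent hsum hv hh).symm

end DirichletGap

section RegularGraph

variable {D V : Type*} [Fintype D] {ρ : D × V → D × V}

/-- The transition operator of simple random walk on the regular graph whose edges are listed by
the rotation map `ρ`: leaving `x` through port `e`, one arrives at the vertex `(ρ (e, x)).2`
through its port `(ρ (e, x)).1`. -/
noncomputable def transition (ρ : D × V → D × V) : Module.End ℝ (V → ℝ) where
  toFun f x := (∑ e, f (ρ (e, x)).2) / Fintype.card D
  map_add' f g := by
    funext x
    simp [Finset.sum_add_distrib, add_div]
  map_smul' c f := by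
    funext x
    simp [← Finset.mul_sum, mul_div_assoc]

lemma transition_apply (f : V → ℝ) (x : V) :
    transition ρ f x = (∑ e, f (ρ (e, x)).2) / Fintype.card D := rfl

/-- The mean amplitude over the coin register at the vertex `x`. -/
noncomputable def coinMean (x : V) : EuclideanSpace ℂ (D × V) →ₗ[ℂ] ℂ where
  toFun φ := (∑ e, φ (e, x)) / Fintype.card D
  map_add' φ χ := by simp [Finset.sum_add_distrib, add_div]
  map_smul' c φ := by simp [← Finset.mul_sum, mul_div_assoc]

lemma coinMean_apply (x : V) (φ : EuclideanSpace ℂ (D × V)) :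
    coinMean x φ = (∑ e, φ (e, x)) / Fintype.card D := rfl

/-- One step of the coined quantum walk with marked vertex `v` on the graph with rotation map `ρ`:
the Grover coin `2 |s⟩⟨s| - 1` off `v` and the coin `-1` at `v`, followed by the shift along `ρ`.
The amplitude at `b` is read off at `ρ b`, which is the shift along `ρ` when `ρ` is involutive. -/
noncomputable def searchStep [DecidableEq V] (ρ : D × V → D × V) (v : V) :
    Module.End ℂ (EuclideanSpace ℂ (D × V)) where
  toFun φ := WithLp.toLp 2 fun b =>
    (if (ρ b).2 = v then 0 else 2 * coinMean (ρ b).2 φ) - φ (ρ b)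
  map_add' φ χ := by
    ext b
    simp only [map_add, PiLp.add_apply]
    split_ifs <;> ring
  map_smul' c φ := by
    ext b
    simp only [map_smul, PiLp.smul_apply, smul_eq_mul, RingHom.id_apply]
    split_ifs <;> ring

lemma searchStep_apply [DecidableEq V] (v : V) (φ : EuclideanSpace ℂ (D × V)) (b : D × V) :
    searchStep ρ v φ b = (if (ρ b).2 = v then 0 else 2 * coinMean (ρ b).2 φ) - φ (ρ b) := rfl

/-- The unit vector whose amplitudes are all equal. -/
noncomputable def uniformState (D V : Type*) [Fintype D] [Fintype V] : EuclideanSpace ℂ (D × V) :=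
  WithLp.toLp 2 fun _ => ((1 / √(Fintype.card D * Fintype.card V) : ℝ) : ℂ)

/-- The probability of measuring the marked vertex `v` after `t` steps from the uniform state. -/
noncomputable def hitProb [Fintype V] [DecidableEq V] (ρ : D × V → D × V) (v : V) (t : ℕ) : ℝ :=
  ∑ e, ‖(searchStep ρ v ^ t) (uniformState D V) (e, v)‖ ^ 2

lemma searchStep_pow_uniformState_translate [Fintype V] [DecidableEq V] {τ : V ≃ V}
    (hτ : ∀ e x, ρ (e, τ x) = ((ρ (e, x)).1, τ (ρ (e, x)).2)) (v : V) (t : ℕ) (e : D) (x : V) :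
    (searchStep ρ (τ v) ^ t) (uniformState D V) (e, τ x) =
      (searchStep ρ v ^ t) (uniformState D V) (e, x) := by
  induction t generalizing e x with
  | zero => rfl
  | succ t ih =>
    simp only [pow_succ', Module.End.mul_apply, searchStep_apply, coinMean_apply, hτ, ih,
      τ.apply_eq_iff_eq]

lemma hitProb_translate [Fintype V] [DecidableEq V] {τ : V ≃ V}
    (hτ : ∀ e x, ρ (e, τ x) = ((ρ (e, x)).1, τ (ρ (e, x)).2)) (v : V) (t : ℕ) :
    hitProb ρ (τ v) t = hitProb ρ v t := by
  simp only [hitProb, searchStep_pow_uniformState_translate hτ]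

variable [Nonempty D]

lemma sum_norm_two_mul_mean_sub_sq (φ : D → ℂ) :
    ∑ e, ‖2 * ((∑ e', φ e') / Fintype.card D) - φ e‖ ^ 2 = ∑ e, ‖φ e‖ ^ 2 := by
  set m := (∑ e', φ e') / Fintype.card D with hm
  have hsum : ∑ e, φ e = Fintype.card D * m := by
    rw [hm, mul_div_cancel₀ _ (Nat.cast_ne_zero.2 Fintype.card_ne_zero)]
  have hinner : ∑ e, inner ℝ (2 * m) (φ e) = Fintype.card D * (2 * ‖m‖ ^ 2) := by
    have htwo : 2 * m = (2 : ℝ) • m := by simp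
    have hcard : (Fintype.card D : ℂ) * m = (Fintype.card D : ℝ) • m := by simp
    rw [← inner_sum, hsum, htwo, hcard, real_inner_smul_left, real_inner_smul_right,
      real_inner_self_eq_norm_sq]
    ring
  simp only [norm_sub_sq_real, Finset.sum_add_distrib, Finset.sum_sub_distrib, ← Finset.mul_sum,
    hinner, norm_mul, Complex.norm_ofNat, Finset.sum_const, Finset.card_univ, nsmul_eq_mul]
  ring

lemma card_mul_norm_coinMean_sq_le (x : V) (φ : EuclideanSpace ℂ (D × V)) :
    Fintype.card D * ‖coinMean x φ‖ ^ 2 ≤ ∑ e, ‖φ (e, x)‖ ^ 2 := by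
  have hD : (0 : ℝ) < Fintype.card D := Nat.cast_pos.2 Fintype.card_pos
  calc Fintype.card D * ‖coinMean x φ‖ ^ 2
      = ‖∑ e, φ (e, x)‖ ^ 2 / Fintype.card D := by
        rw [coinMean_apply, norm_div, Complex.norm_natCast]
        field_simp
    _ ≤ ∑ e, ‖φ (e, x)‖ ^ 2 := (div_le_iff₀' hD).2 <|
        (pow_le_pow_left₀ (norm_nonneg _) (norm_sum_le _ _) 2).trans sq_sum_le_card_mul_sum_sq

variable [Fintype V]

lemma sum_transition (hρ : Function.Involutive ρ) (f : V → ℝ) :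
    ∑ x, transition ρ f x = ∑ x, f x := by
  have hshift : ∑ b : D × V, f (ρ b).2 = ∑ b : D × V, f b.2 :=
    Equiv.sum_comp hρ.toPerm fun b => f b.2
  simp only [transition_apply]
  rw [← Finset.sum_div, ← Fintype.sum_prod_type_right (fun b : D × V => f (ρ b).2), hshift,
    Fintype.sum_prod_type]
  simp

lemma sqrt_card_mul_norm_coinMean_le (x : V) (φ : EuclideanSpace ℂ (D × V)) :
    √(Fintype.card D) * ‖coinMean x φ‖ ≤ ‖φ‖ := by
  refine le_of_sq_le_sq ?_ (norm_nonneg _)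
  rw [mul_pow, Real.sq_sqrt (Nat.cast_nonneg _), EuclideanSpace.norm_sq_eq,
    Fintype.sum_prod_type_right]
  exact (card_mul_norm_coinMean_sq_le x φ).trans <| Finset.single_le_sum
    (f := fun x => ∑ e, ‖φ (e, x)‖ ^ 2) (fun x _ => by positivity) (Finset.mem_univ x)

lemma norm_searchStep [DecidableEq V] (hρ : Function.Involutive ρ) (v : V)
    (φ : EuclideanSpace ℂ (D × V)) : ‖searchStep ρ v φ‖ = ‖φ‖ := by
  refine (pow_left_inj₀ (norm_nonneg _) (norm_nonneg _) two_ne_zero).1 ?_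
  have hshift : ∑ b, ‖searchStep ρ v φ b‖ ^ 2 =
      ∑ b : D × V, ‖(if b.2 = v then 0 else 2 * coinMean b.2 φ) - φ b‖ ^ 2 :=
    Equiv.sum_comp hρ.toPerm fun b => ‖(if b.2 = v then 0 else 2 * coinMean b.2 φ) - φ b‖ ^ 2
  rw [EuclideanSpace.norm_sq_eq, EuclideanSpace.norm_sq_eq, hshift, Fintype.sum_prod_type_right,
    Fintype.sum_prod_type_right]
  refine Finset.sum_congr rfl fun x _ => ?_
  rcases eq_or_ne x v with rfl | hx
  · simp
  · simpa [hx, coinMean_apply] using sum_norm_two_mul_mean_sub_sq fun e => φ (e, x)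

lemma norm_uniformState [Nonempty V] : ‖uniformState D V‖ = 1 := by
  have hD : (Fintype.card D : ℝ) ≠ 0 := Nat.cast_ne_zero.2 Fintype.card_ne_zero
  have hV : (Fintype.card V : ℝ) ≠ 0 := Nat.cast_ne_zero.2 Fintype.card_ne_zero
  rw [← sq_eq_sq₀ (norm_nonneg _) zero_le_one, EuclideanSpace.norm_sq_eq]
  simp only [uniformState, Complex.norm_real, Real.norm_eq_abs, sq_abs, div_pow, one_pow,
    Real.sq_sqrt (by positivity : (0 : ℝ) ≤ Fintype.card D * Fintype.card V), Finset.sum_const,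
    Finset.card_univ, Fintype.card_prod, nsmul_eq_mul, Nat.cast_mul]
  field_simp

end RegularGraph

section SearchTime

variable {D V : Type*} [Fintype D] [Fintype V] {ρ : D × V → D × V} {v : V} {r γ : ℝ} {h : V → ℝ}

/-- The discounted sum `∑ t, r ^ t • L ^ t` of the walk `L = searchStep ρ v` from the uniform
state, expressed through the solution `h` of the resolvent equation of the random walk killed
at `v`. -/
noncomputable def discountedState (ρ : D × V → D × V) (r : ℝ) (h : V → ℝ) :
    EuclideanSpace ℂ (D × V) :=
  WithLp.toLp 2 fun b =>
    (((1 + h (ρ b).2 - r * h b.2) / (1 + r) / √(Fintype.card D * Fintype.card V) : ℝ) : ℂ)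

lemma discountedState_apply (b : D × V) : discountedState ρ r h b =
    (((1 + h (ρ b).2 - r * h b.2) / (1 + r) / √(Fintype.card D * Fintype.card V) : ℝ) : ℂ) := rfl

lemma coinMean_discountedState [Nonempty D] (x : V) :
    coinMean x (discountedState ρ r h) = (((1 + transition ρ h x - r * h x) / (1 + r) /
      √(Fintype.card D * Fintype.card V) : ℝ) : ℂ) := by
  have hD : (Fintype.card D : ℝ) ≠ 0 := Nat.cast_ne_zero.2 Fintype.card_ne_zero
  simp only [coinMean_apply, discountedState_apply, transition_apply]
  rw [← Complex.ofReal_sum, ← Complex.ofReal_natCast, ← Complex.ofReal_div, ← Finset.sum_div,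
    ← Finset.sum_div, Finset.sum_sub_distrib, Finset.sum_add_distrib]
  congr 1
  simp only [Finset.sum_const, Finset.card_univ, nsmul_eq_mul]
  field_simp

lemma le_sqrt_card_mul_norm_coinMean_discountedState [Nonempty D] [Nonempty V] (hr : 0 < 1 + r)
    (hv : h v = 0) {q : ℝ} (hq : Fintype.card V * q ≤ 1 + transition ρ h v) :
    √(Fintype.card V) * q / (1 + r) ≤
      √(Fintype.card D) * ‖coinMean v (discountedState ρ r h)‖ := by
  have : (0 : ℝ) < √(Fintype.card D) := Real.sqrt_pos.2 (Nat.cast_pos.2 Fintype.card_pos)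
  have : (0 : ℝ) < √(Fintype.card V) := Real.sqrt_pos.2 (Nat.cast_pos.2 Fintype.card_pos)
  rw [coinMean_discountedState, Complex.norm_real, Real.norm_eq_abs, hv, mul_zero, sub_zero,
    Real.sqrt_mul (Nat.cast_nonneg _)]
  calc √(Fintype.card V) * q / (1 + r)
      = Fintype.card V * q / (1 + r) / √(Fintype.card V) := by
        nth_rw 2 [← Real.mul_self_sqrt (Nat.cast_nonneg (Fintype.card V))]
        field_simp
    _ ≤ (1 + transition ρ h v) / (1 + r) / √(Fintype.card V) := by gcongr
    _ = √(Fintype.card D) *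
          ((1 + transition ρ h v) / (1 + r) / (√(Fintype.card D) * √(Fintype.card V))) := by
        field_simp
    _ ≤ _ := by
        gcongr
        exact le_abs_self _

variable [DecidableEq V]

lemma discountedState_sub_smul_searchStep [Nonempty D] (hρ : Function.Involutive ρ) (hr : 0 < r)
    (hv : h v = 0) (hh : ∀ x, x ≠ v → (1 + (1 - r) ^ 2 / (2 * r)) * h x - transition ρ h x = 1) :
    discountedState ρ r h - (r : ℂ) • searchStep ρ v (discountedState ρ r h) =
      uniformState D V := by
  ext b
  simp only [PiLp.sub_apply, PiLp.smul_apply, smul_eq_mul, searchStep_apply,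
    coinMean_discountedState, discountedState_apply, hρ b, uniformState]
  generalize (ρ b).2 = x
  generalize √(Fintype.card D * Fintype.card V : ℝ) = c
  have hr' : 1 + r ≠ 0 := by positivity
  split_ifs with hxv
  · norm_cast
    rw [hxv, hv]
    field_simp
    ring
  · have hres := hh x hxv
    norm_cast
    field_simp at hres ⊢
    linear_combination hres / c

/-- If `v` is unlikely to be hit before time `T`, the discounted state has a small amplitude at
`v`; but that amplitude is a discounted return time to `v`, which the gap bounds below. -/
lemma HasDirichletGap.le_of_hitProb_le [Nonempty D] [Nonempty V]
    (hP : HasDirichletGap (transition ρ) v γ) (hρ : Function.Involutive ρ) (hγ : 0 < γ)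
    (hr : 0 < r) (hr1 : r ≤ 1) {p : ℝ} (hp : 0 ≤ p) {T : ℕ}
    (hT : ∀ t < T, hitProb ρ v t ≤ p ^ 2) :
    (1 - r) * (√(Fintype.card V) * (γ / (γ + (1 - r) ^ 2 / (2 * r))) / (1 + r)) ≤
      (1 - r ^ T) * p + r ^ T := by
  have hε : 0 ≤ (1 - r) ^ 2 / (2 * r) := by positivity
  have hγε : 0 < γ + (1 - r) ^ 2 / (2 * r) := by positivity
  obtain ⟨h, hv, hh⟩ := hP.exists_killed_resolvent hγε 1
  have hreturn := hP.le_one_add_killed_resolvent (sum_transition hρ) hε hγε hv hh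
  let m : EuclideanSpace ℂ (D × V) →ₗ[ℂ] ℂ := (√(Fintype.card D) : ℂ) • coinMean v
  have hm (φ) : ‖m φ‖ = √(Fintype.card D) * ‖coinMean v φ‖ := by
    simp [m, abs_of_nonneg (Real.sqrt_nonneg _)]
  have hr_norm : ‖(r : ℂ)‖ = r := by simp [abs_of_pos hr]
  have hhit (t : ℕ) (ht : t < T) : ‖m ((searchStep ρ v ^ t) (uniformState D V))‖ ≤ p := by
    refine le_of_sq_le_sq ?_ hp
    rw [hm, mul_pow, Real.sq_sqrt (Nat.cast_nonneg _)]
    exact (card_mul_norm_coinMean_sq_le _ _).trans (hT t ht)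
  have hdisc := one_sub_norm_mul_norm_resolvent_le (fun φ => (norm_searchStep hρ v φ).le)
    (hr_norm.trans_le hr1) (discountedState_sub_smul_searchStep hρ hr hv hh) m zero_le_one
    (fun φ => by simpa only [hm, one_mul] using sqrt_card_mul_norm_coinMean_le v φ) hhit
  rw [hr_norm, hm, norm_uniformState, mul_one, mul_one] at hdisc
  refine le_trans ?_ hdisc
  gcongr
  exact le_sqrt_card_mul_norm_coinMean_discountedState (by positivity) hv hreturn

lemma pow_ceil_log_div_one_sub_le {a : ℝ} (hr : 0 ≤ r) (hr1 : r < 1) (ha : 0 < a) :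
    r ^ ⌈Real.log a / (1 - r)⌉₊ ≤ 1 / a := by
  have hlog : Real.log a ≤ ⌈Real.log a / (1 - r)⌉₊ * (1 - r) :=
    (div_le_iff₀ (sub_pos.2 hr1)).1 (Nat.le_ceil _)
  have hexp : r ≤ Real.exp (-(1 - r)) := by simpa using Real.one_sub_le_exp_neg (1 - r)
  calc r ^ ⌈Real.log a / (1 - r)⌉₊
      ≤ Real.exp (-(1 - r)) ^ ⌈Real.log a / (1 - r)⌉₊ := by gcongr
    _ = Real.exp (-(⌈Real.log a / (1 - r)⌉₊ * (1 - r))) := by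
        rw [← Real.exp_nat_mul]
        ring_nf
    _ ≤ Real.exp (-Real.log a) := by gcongr
    _ = 1 / a := by rw [Real.exp_neg, Real.exp_log ha, one_div]

lemma two_div_le_discounted_amplitude {s c : ℝ} (hs : 1 ≤ s) (hc : 0 < c) (hr : r = s / (s + 1)) :
    2 / (3 * (c + 2)) ≤
      (1 - r) * (s * (1 / (c * s ^ 2) / (1 / (c * s ^ 2) + (1 - r) ^ 2 / (2 * r))) / (1 + r)) :=
  calc 2 / (3 * (c + 2)) = 1 / 3 * (2 / (2 + c)) := by
        field_simp
        ring
    _ ≤ s / (2 * s + 1) * (2 / (2 + c * (s / (s + 1)))) := by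
        gcongr ?_ * (2 / (2 + ?_))
        · rw [div_le_div_iff₀ (by norm_num) (by positivity)]
          linarith
        · exact mul_le_of_le_one_right hc.le ((div_le_one (by positivity)).2 (by linarith))
    _ = _ := by
        have : 1 - r = 1 / (s + 1) := by
          rw [hr]
          field_simp
          ring
        rw [this, hr]
        field_simp
        ring

/-- The discount factor is chosen so that `1 - r` is of order `1 / √N`: then the discounted state
has an amplitude of order `1` at `v`, and so has the walk within the first `O(√N)` steps. -/
theorem HasDirichletGap.exists_le_hitProb [Nonempty D] [Nonempty V] {c : ℝ} (hc : 0 < c)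
    (hP : HasDirichletGap (transition ρ) v (1 / (c * Fintype.card V)))
    (hρ : Function.Involutive ρ) :
    ∃ T : ℕ, (T : ℝ) ≤ 2 * Real.log (3 * (c + 2)) * √(Fintype.card V) ∧
      (1 / (3 * (c + 2))) ^ 2 ≤ hitProb ρ v T := by
  obtain ⟨s, hs⟩ : ∃ s, s = √(Fintype.card V) := ⟨_, rfl⟩
  have hs1 : 1 ≤ s := hs ▸ Real.one_le_sqrt.2 (Nat.one_le_cast.2 Fintype.card_pos)
  have hcard : (Fintype.card V : ℝ) = s ^ 2 := hs ▸ (Real.sq_sqrt (Nat.cast_nonneg _)).symm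
  obtain ⟨r, hr⟩ : ∃ r, r = s / (s + 1) := ⟨_, rfl⟩
  have hr0 : 0 < r := hr ▸ by positivity
  have hr1 : r < 1 := hr ▸ (div_lt_one (by positivity)).2 (by linarith)
  have hr_inv : 1 / (1 - r) ≤ 2 * s := by
    rw [hr, one_sub_div (by positivity), one_div_div, add_sub_cancel_left, div_one]
    linarith
  have hlog : 0 ≤ Real.log (3 * (c + 2)) := Real.log_nonneg (by linarith)
  have hpow := pow_ceil_log_div_one_sub_le hr0.le hr1 (a := 3 * (c + 2)) (by positivity)
  by_contra! hT
  have hsmall (t : ℕ) (ht : t < ⌈Real.log (3 * (c + 2)) / (1 - r)⌉₊) :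
      hitProb ρ v t ≤ (1 / (3 * (c + 2))) ^ 2 := by
    refine (hT t ?_).le
    calc (t : ℝ) ≤ Real.log (3 * (c + 2)) * (1 / (1 - r)) := by
          rw [mul_one_div]
          exact (Nat.lt_ceil.1 ht).le
      _ ≤ Real.log (3 * (c + 2)) * (2 * s) := by gcongr
      _ = 2 * Real.log (3 * (c + 2)) * √(Fintype.card V) := by
          rw [hs]
          ring
  have hle := hP.le_of_hitProb_le hρ (by positivity) hr0 hr1.le (by positivity) hsmall
  rw [← hs, hcard] at hle
  have hamp := (two_div_le_discounted_amplitude hs1 hc hr).trans hle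
  have hpos : 0 < r ^ ⌈Real.log (3 * (c + 2)) / (1 - r)⌉₊ * (1 / (3 * (c + 2))) := by positivity
  rw [← mul_one_div 2] at hamp
  linarith

end SearchTime

section Fourier

open scoped ComplexConjugate

lemma sum_norm_sq_le_of_sum_eq_zero {ι E : Type*} [Fintype ι] [DecidableEq ι]
    [SeminormedAddCommGroup E] {F : ι → E} {ω : ι → ℝ} {i₀ : ι} (hF : ∑ i, F i = 0)
    (hω : ∀ i, i ≠ i₀ → 0 < ω i) :
    ∑ i, ‖F i‖ ^ 2 ≤
      2 * (∑ i with i ≠ i₀, 1 / ω i) * ∑ i with i ≠ i₀, ω i * ‖F i‖ ^ 2 := by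
  have hi₀ : ‖F i₀‖ ≤ ∑ i with i ≠ i₀, ‖F i‖ := by
    rw [← Finset.add_sum_erase _ _ (Finset.mem_univ i₀), ← Finset.filter_ne'] at hF
    rw [eq_neg_of_add_eq_zero_left hF, norm_neg]
    exact norm_sum_le _ _
  have hsq : ∑ i with i ≠ i₀, ‖F i‖ ^ 2 ≤ (∑ i with i ≠ i₀, ‖F i‖) ^ 2 :=
    Finset.sum_sq_le_sq_sum_of_nonneg fun i _ => norm_nonneg (F i)
  have hCS : (∑ i with i ≠ i₀, ‖F i‖) ^ 2 ≤
      (∑ i with i ≠ i₀, 1 / ω i) * ∑ i with i ≠ i₀, ω i * ‖F i‖ ^ 2 := by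
    refine Finset.sum_sq_le_sum_mul_sum_of_sq_le_mul _ (fun i hi => ?_) (fun i hi => ?_)
      fun i hi => le_of_eq ?_ <;> have hωi := hω i (Finset.mem_filter.1 hi).2
    · positivity
    · positivity
    · field_simp
  calc ∑ i, ‖F i‖ ^ 2 = ‖F i₀‖ ^ 2 + ∑ i with i ≠ i₀, ‖F i‖ ^ 2 := by
        rw [Finset.filter_ne', Finset.add_sum_erase _ (fun i => ‖F i‖ ^ 2) (Finset.mem_univ i₀)]
    _ ≤ (∑ i with i ≠ i₀, ‖F i‖) ^ 2 + (∑ i with i ≠ i₀, ‖F i‖) ^ 2 := by gcongr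
    _ ≤ _ := by linarith

/-- The additive character `x ↦ ∏ i, χ (x i)` of `ι → R`; its multiplicative shifts are all the
characters of `ι → R` when `χ` is primitive. -/
noncomputable def piChar (ι : Type*) {R : Type*} [Fintype ι] [AddMonoid R] (χ : AddChar R ℂ) :
    AddChar (ι → R) ℂ where
  toFun x := ∏ i, χ (x i)
  map_zero_eq_one' := by simp
  map_add_eq_mul' x y := by simp [AddChar.map_add_eq_mul, Finset.prod_mul_distrib]

lemma piChar_single {ι R : Type*} [Fintype ι] [DecidableEq ι] [AddMonoid R] (χ : AddChar R ℂ)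
    (i : ι) (r : R) : piChar ι χ (Pi.single i r) = χ r := by
  change ∏ j, χ ((Pi.single i r : ι → R) j) = χ r
  rw [Finset.prod_eq_single i (fun j _ hj => by simp [hj]) (by simp), Pi.single_eq_same]

lemma isPrimitive_piChar {ι R : Type*} [Fintype ι] [CommRing R] {χ : AddChar R ℂ}
    (hχ : χ.IsPrimitive) : (piChar ι χ).IsPrimitive := by
  classical
  intro a ha h
  obtain ⟨i, hi⟩ := Function.ne_iff.1 ha
  refine hχ hi (DFunLike.ext _ _ fun r => ?_)
  simpa [AddChar.mulShift_apply, ← Pi.single_mul_right, piChar_single] using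
    DFunLike.congr_fun h (Pi.single i r)

variable {A : Type*} [CommRing A] [Fintype A] {ψ : AddChar A ℂ}

/-- The unnormalised Fourier transform on a finite ring whose characters are the multiplicative
shifts of `ψ`. -/
noncomputable def dft (ψ : AddChar A ℂ) (f : A → ℂ) (k : A) : ℂ := ∑ x, f x * ψ (k * x)

lemma dft_add_right (f : A → ℂ) (a k : A) :
    dft ψ (fun x => f (x + a)) k = ψ (-(k * a)) * dft ψ f k := by
  rw [dft, dft, Finset.mul_sum]
  refine Fintype.sum_equiv (Equiv.addRight a) _ _ fun x => ?_
  rw [Equiv.coe_addRight, mul_left_comm, ← AddChar.map_add_eq_mul]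
  ring_nf

lemma sum_dft (hψ : ψ.IsPrimitive) (f : A → ℂ) :
    ∑ k, dft ψ f k = Fintype.card A * f 0 := by
  classical
  simp only [dft]
  rw [Finset.sum_comm]
  simp [← Finset.mul_sum, AddChar.sum_mulShift _ hψ, mul_comm (f 0)]

lemma sum_conj_dft_mul_dft (hψ : ψ.IsPrimitive) (f g : A → ℂ) :
    ∑ k, conj (dft ψ f k) * dft ψ g k = Fintype.card A * ∑ x, conj (f x) * g x := by
  classical
  have hexpand (k : A) : conj (dft ψ f k) * dft ψ g k =
      ∑ x, ∑ y, conj (f x) * g y * ψ (k * (y - x)) := by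
    simp only [dft, map_sum, map_mul, ← AddChar.map_neg_eq_conj, Finset.sum_mul_sum]
    refine Finset.sum_congr rfl fun x _ => Finset.sum_congr rfl fun y _ => ?_
    rw [mul_mul_mul_comm, ← AddChar.map_add_eq_mul]
    ring_nf
  simp only [hexpand]
  rw [Finset.sum_comm, Finset.mul_sum]
  refine Finset.sum_congr rfl fun x _ => ?_
  rw [Finset.sum_comm]
  simp only [← Finset.mul_sum, AddChar.sum_mulShift _ hψ, sub_eq_zero]
  simp [mul_comm]

lemma sum_mul_norm_dft_sq (hψ : ψ.IsPrimitive) {f g : A → ℝ} {σ : A → ℝ}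
    (hfg : ∀ k, dft ψ (fun x => (g x : ℂ)) k = σ k * dft ψ (fun x => (f x : ℂ)) k) :
    ∑ k, σ k * ‖dft ψ (fun x => (f x : ℂ)) k‖ ^ 2 = Fintype.card A * ∑ x, f x * g x := by
  have hpair := sum_conj_dft_mul_dft hψ (fun x => (f x : ℂ)) fun x => (g x : ℂ)
  simp only [hfg, mul_left_comm (conj _), Complex.conj_mul', Complex.conj_ofReal] at hpair
  exact_mod_cast hpair

lemma hasDirichletGap_of_dft (hψ : ψ.IsPrimitive) {P : Module.End ℝ (A → ℝ)} {σ : A → ℝ}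
    (hP : ∀ f k, dft ψ (fun x => (P f x : ℂ)) k = σ k * dft ψ (fun x => (f x : ℂ)) k)
    (hσ₀ : σ 0 ≤ 1) (hσ : ∀ k, k ≠ 0 → σ k < 1) [DecidableEq A] {S : ℝ} (hS : 0 < S)
    (hsum : ∑ k with k ≠ 0, 1 / (1 - σ k) ≤ S) : HasDirichletGap P 0 (1 / (2 * S)) := by
  intro f hf
  set F := dft ψ fun x => (f x : ℂ)
  have hcard : (0 : ℝ) < Fintype.card A := Nat.cast_pos.2 Fintype.card_pos
  have hParseval : ∑ k, ‖F k‖ ^ 2 = Fintype.card A * ∑ x, f x ^ 2 := by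
    simpa [sq] using sum_mul_norm_dft_sq hψ (f := f) (g := f) (σ := 1) (by simp)
  have henergy : ∑ k, (1 - σ k) * ‖F k‖ ^ 2 = Fintype.card A * ∑ x, f x * (f x - P f x) := by
    simp only [sub_mul, one_mul, mul_sub, Finset.sum_sub_distrib, ← sq]
    rw [hParseval, sum_mul_norm_dft_sq hψ (hP f)]
  have hF : ∑ k, F k = 0 := by simp [F, sum_dft hψ, hf]
  have hle : Fintype.card A * ∑ x, f x ^ 2 ≤
      Fintype.card A * (2 * S * ∑ x, f x * (f x - P f x)) :=
    calc Fintype.card A * ∑ x, f x ^ 2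
        ≤ 2 * (∑ k with k ≠ 0, 1 / (1 - σ k)) * ∑ k with k ≠ 0, (1 - σ k) * ‖F k‖ ^ 2 :=
          hParseval ▸ sum_norm_sq_le_of_sum_eq_zero hF fun k hk => sub_pos.2 (hσ k hk)
      _ ≤ 2 * S * ∑ k, (1 - σ k) * ‖F k‖ ^ 2 := by
          have hσ_le (k : A) : σ k ≤ 1 := by
            rcases eq_or_ne k 0 with rfl | hk
            exacts [hσ₀, (hσ k hk).le]
          have hterm (k : A) : 0 ≤ (1 - σ k) * ‖F k‖ ^ 2 :=
            mul_nonneg (sub_nonneg.2 (hσ_le k)) (sq_nonneg _)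
          gcongr
          · exact Finset.sum_nonneg fun k _ => hterm k
          · exact fun k _ _ => hterm k
          · exact Finset.subset_univ _
      _ = _ := by
          rw [henergy]
          ring
  rw [one_div_mul_eq_div, div_le_iff₀' (by positivity)]
  exact le_of_mul_le_mul_left hle hcard

end Fourier

section Torus

lemma kronecker_diagonal_mulVec_apply {α ι κ : Type*} [CommSemiring α] [Fintype ι] [Fintype κ]
    [DecidableEq κ] (A : Matrix ι ι α) (a : κ → α) (φ : ι × κ → α) (i : ι) (k : κ) :
    ((A ⊗ₖ Matrix.diagonal a) *ᵥ φ) (i, k) = a k * (A *ᵥ fun j => φ (j, k)) i := by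
  simp only [Matrix.mulVec, dotProduct, Fintype.sum_prod_type, Matrix.kronecker_apply,
    Matrix.diagonal_apply, mul_ite, ite_mul, mul_zero, zero_mul, Finset.sum_ite_eq,
    Finset.mem_univ, if_true, Finset.mul_sum]
  exact Finset.sum_congr rfl fun j _ => by ring

variable {d n : ℕ}

lemma flipFlop_involutive : Function.Involutive (flipFlop : Label d n → Label d n) := by
  rintro ⟨⟨i, s⟩, x⟩
  cases s <;> simp [flipFlop, neighbor]

lemma flipFlop_add (e : Direction d) (x v : Vertex d n) :
    flipFlop (e, x + v) = ((flipFlop (e, x)).1, (flipFlop (e, x)).2 + v) := by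
  simp only [flipFlop, neighbor]
  split_ifs <;> simp [add_right_comm, sub_add_eq_add_sub]

lemma coinFlip_mulVec (φ : Direction d → ℂ) (e : Direction d) :
    (coinFlip d *ᵥ φ) e = 2 * ((∑ e', φ e') / Fintype.card (Direction d)) - φ e := by
  have hsq : ((√(2 * d : ℝ) : ℝ) : ℂ) * (√(2 * d : ℝ) : ℝ) = 2 * d := by
    rw [← Complex.ofReal_mul, Real.mul_self_sqrt (by positivity)]
    push_cast
    rfl
  have hproj : coinUniform d e * (star (coinUniform d) ⬝ᵥ φ) =
      (∑ e', φ e') / Fintype.card (Direction d) := by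
    simp only [coinUniform, dotProduct, Pi.star_apply, Complex.star_def, map_div₀, map_one,
      Complex.conj_ofReal, ← Finset.mul_sum]
    rw [← mul_assoc, div_mul_div_comm, hsq, one_mul, one_div_mul_eq_div]
    simp [mul_comm]
  simp only [coinFlip, Matrix.sub_mulVec, Matrix.smul_mulVec, Matrix.vecMulVec_mulVec,
    Matrix.one_mulVec, Pi.sub_apply, Pi.smul_apply, op_smul_eq_smul, smul_eq_mul]
  rw [mul_comm _ (coinUniform d e), hproj]

lemma cos_modeAngle (k : Vertex d n) :
    Real.cos (modeAngle k) =
      (1 / (d : ℝ)) * ∑ i, Real.cos (2 * Real.pi * ((k i).val : ℝ) / (n : ℝ)) := by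
  have hsum : |∑ i, Real.cos (2 * Real.pi * ((k i).val : ℝ) / (n : ℝ))| ≤ d := by
    refine (Finset.abs_sum_le_sum_abs _ _).trans ?_
    exact (Finset.sum_le_sum fun i _ => Real.abs_cos_le_one _).trans (by simp)
  have hmean : |(1 / (d : ℝ)) * ∑ i, Real.cos (2 * Real.pi * ((k i).val : ℝ) / (n : ℝ))| ≤ 1 := by
    rw [abs_mul, abs_of_nonneg (by positivity), one_div_mul_eq_div]
    exact div_le_one_of_le₀ hsum (by positivity)
  exact Real.cos_arccos (abs_le.1 hmean).1 (abs_le.1 hmean).2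

lemma one_sub_cos_modeAngle (hd : d ≠ 0) (k : Vertex d n) :
    1 - Real.cos (modeAngle k) =
      (∑ i, (1 - Real.cos (2 * Real.pi * ((k i).val : ℝ) / n))) / d := by
  simp only [cos_modeAngle, Finset.sum_sub_distrib, Finset.sum_const, Finset.card_univ,
    Fintype.card_fin, nsmul_eq_mul, mul_one]
  field_simp

variable [NeZero n]

lemma card_vertex : (Fintype.card (Vertex d n) : ℝ) = n ^ d := by
  simp [ZMod.card]

lemma shift_mulVec (φ : Label d n → ℂ) (b : Label d n) :
    (shift d n *ᵥ φ) b = φ (flipFlop b) := by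
  simp only [Matrix.mulVec, dotProduct, shift, Matrix.of_apply]
  simp only [← flipFlop_involutive.eq_iff (x := b), ite_mul, one_mul, zero_mul, Finset.sum_ite_eq,
    Finset.mem_univ, if_true]

lemma perturbedCoin_mulVec (v : Vertex d n) (φ : Label d n → ℂ) (b : Label d n) :
    (perturbedCoin v *ᵥ φ) b =
      (if b.2 = v then 0 else 2 * coinMean b.2 (WithLp.toLp 2 φ)) - φ b := by
  rw [perturbedCoin, vertexProj, ← Matrix.diagonal_single, ← Matrix.diagonal_one,
    Matrix.diagonal_sub, markingCoin, Matrix.add_mulVec, Pi.add_apply, ← Prod.mk.eta (p := b),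
    kronecker_diagonal_mulVec_apply, kronecker_diagonal_mulVec_apply, coinFlip_mulVec,
    Matrix.neg_mulVec, Matrix.one_mulVec, coinMean_apply]
  rcases eq_or_ne b.2 v with hb | hb <;> simp [hb]

lemma walkStep_mulVec (v : Vertex d n) (φ : Label d n → ℂ) :
    walkStep v *ᵥ φ = (searchStep flipFlop v (WithLp.toLp 2 φ)).ofLp := by
  funext b
  rw [walkStep, ← Matrix.mulVec_mulVec, shift_mulVec, perturbedCoin_mulVec, searchStep_apply]

lemma stateAfter_eq (v : Vertex d n) (t : ℕ) :
    stateAfter v t = ((searchStep flipFlop v ^ t) (uniformState _ _)).ofLp := by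
  induction t with
  | zero =>
    funext b
    simp [stateAfter, initialState, uniformState, mul_comm]
  | succ t ih =>
    rw [stateAfter, pow_succ', ← Matrix.mulVec_mulVec, ← stateAfter, ih, walkStep_mulVec,
      pow_succ', Module.End.mul_apply]

lemma successProb_eq_hitProb (v : Vertex d n) (t : ℕ) : successProb v t = hitProb flipFlop v t := by
  simp only [successProb, hitProb, stateAfter_eq]

lemma successProb_eq_hitProb_zero (v : Vertex d n) (t : ℕ) :
    successProb v t = hitProb flipFlop (0 : Vertex d n) t := by
  rw [successProb_eq_hitProb]
  simpa using hitProb_translate (τ := Equiv.addRight v) (fun e x => flipFlop_add e x v) 0 t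

lemma stdAddChar_add_neg (a : ZMod n) :
    (ZMod.stdAddChar a + ZMod.stdAddChar (-a) : ℂ) =
      2 * (Real.cos (2 * Real.pi * (a.val : ℝ) / n) : ℝ) := by
  have harg : (2 * Real.pi * Complex.I * a.val / n : ℂ) =
      ((2 * Real.pi * (a.val : ℝ) / n : ℝ) : ℂ) * Complex.I := by
    push_cast
    ring
  rw [AddChar.map_neg_eq_conj, Complex.add_conj, ZMod.stdAddChar_apply, ZMod.toCircle_apply, harg,
    Complex.exp_ofReal_mul_I_re]
  push_cast
  rfl

lemma dft_transition_flipFlop (f : Vertex d n → ℝ) (k : Vertex d n) :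
    dft (piChar (Fin d) ZMod.stdAddChar) (fun x => (transition flipFlop f x : ℂ)) k =
      (Real.cos (modeAngle k) : ℝ) *
        dft (piChar (Fin d) ZMod.stdAddChar) (fun x => (f x : ℂ)) k := by
  set Ψ := piChar (Fin d) (ZMod.stdAddChar (N := n))
  set F := dft Ψ (fun x => (f x : ℂ)) k
  have hneighbor (i : Fin d) : dft Ψ (fun x => (f (neighbor (i, true) x) : ℂ)) k +
      dft Ψ (fun x => (f (neighbor (i, false) x) : ℂ)) k =
        2 * (Real.cos (2 * Real.pi * ((k i).val : ℝ) / n) : ℝ) * F := by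
    rw [← stdAddChar_add_neg]
    simp only [neighbor, sub_eq_add_neg, if_true, Bool.false_eq_true, if_false]
    rw [dft_add_right (fun x => (f x : ℂ)), dft_add_right (fun x => (f x : ℂ))]
    simp only [← Pi.single_mul_right, mul_one, ← Pi.single_neg, piChar_single, mul_neg, neg_neg, Ψ]
    ring
  calc dft Ψ (fun x => (transition flipFlop f x : ℂ)) k
      = (∑ e, dft Ψ (fun x => (f (neighbor e x) : ℂ)) k) / (d * 2) := by
        simp only [dft, transition_apply, flipFlop]
        rw [Finset.sum_comm, Finset.sum_div]
        refine Finset.sum_congr rfl fun x _ => ?_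
        simp [Finset.sum_mul, div_mul_eq_mul_div]
    _ = (∑ i, 2 * (Real.cos (2 * Real.pi * ((k i).val : ℝ) / n) : ℝ) * F) / (d * 2) := by
        rw [Fintype.sum_prod_type]
        simp only [Fintype.sum_bool, hneighbor]
    _ = (Real.cos (modeAngle k) : ℝ) * F := by
        rw [← Finset.sum_mul, ← Finset.mul_sum, cos_modeAngle]
        push_cast
        ring

end Torus

section ModeSum

variable {d n : ℕ}

/-- The sup norm on the torus `(ℤ/nℤ)^d`, that is the `ℓ^∞` distance of `k` to `0` in the periodic
grid. -/
def torusNorm (k : Vertex d n) : ℕ := Finset.univ.sup fun i => (k i).valMinAbs.natAbs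

lemma natAbs_valMinAbs_le_torusNorm (k : Vertex d n) (i : Fin d) :
    (k i).valMinAbs.natAbs ≤ torusNorm k :=
  Finset.le_sup (f := fun i => (k i).valMinAbs.natAbs) (Finset.mem_univ i)

lemma torusNorm_pos {k : Vertex d n} (hk : k ≠ 0) : 0 < torusNorm k := by
  obtain ⟨i, hi⟩ := Function.ne_iff.1 hk
  have hki : 0 < (k i).valMinAbs.natAbs := by
    simpa [Nat.pos_iff_ne_zero] using hi
  exact hki.trans_le (natAbs_valMinAbs_le_torusNorm k i)

lemma exists_natAbs_valMinAbs_eq_torusNorm {k : Vertex d n} (hk : k ≠ 0) :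
    ∃ i, (k i).valMinAbs.natAbs = torusNorm k := by
  obtain ⟨i, -⟩ := Function.ne_iff.1 hk
  obtain ⟨j, -, hj⟩ := Finset.exists_mem_eq_sup _ ⟨i, Finset.mem_univ i⟩
    fun i => (k i).valMinAbs.natAbs
  exact ⟨j, hj.symm⟩

variable [NeZero n]

lemma torusNorm_le_half (k : Vertex d n) : torusNorm k ≤ n / 2 :=
  Finset.sup_le fun i _ => (k i).natAbs_valMinAbs_le

lemma card_filter_valMinAbs_mem_le (s : Finset ℤ) :
    (Finset.univ.filter fun a : ZMod n => a.valMinAbs ∈ s).card ≤ s.card :=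
  Finset.card_le_card_of_injOn ZMod.valMinAbs (fun _ ha => (Finset.mem_filter.1 ha).2)
    ZMod.injective_valMinAbs.injOn

lemma card_torusNorm_eq_le (m : ℕ) :
    (Finset.univ.filter fun k : Vertex d n => k ≠ 0 ∧ torusNorm k = m).card ≤
      d * (2 * (2 * m + 1) ^ (d - 1)) := by
  classical
  set ball := Finset.univ.filter fun a : ZMod n => a.valMinAbs ∈ Finset.Icc (-(m : ℤ)) m
  set sphere := Finset.univ.filter fun a : ZMod n => a.valMinAbs ∈ ({(m : ℤ), -(m : ℤ)} : Finset ℤ)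
  have hball : ball.card ≤ 2 * m + 1 := by
    refine (card_filter_valMinAbs_mem_le _).trans ?_
    simp only [Int.card_Icc]
    omega
  have hsphere : sphere.card ≤ 2 := (card_filter_valMinAbs_mem_le _).trans Finset.card_le_two
  have hcover : (Finset.univ.filter fun k : Vertex d n => k ≠ 0 ∧ torusNorm k = m) ⊆
      Finset.univ.biUnion fun i => Fintype.piFinset (Function.update (fun _ => ball) i sphere) := by
    intro k hk
    obtain ⟨hk₀, hkm⟩ := (Finset.mem_filter.1 hk).2
    obtain ⟨i, hi⟩ := exists_natAbs_valMinAbs_eq_torusNorm hk₀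
    refine Finset.mem_biUnion.2 ⟨i, Finset.mem_univ i, Fintype.mem_piFinset.2 fun j => ?_⟩
    rcases eq_or_ne j i with rfl | hj
    · simp only [Function.update_self, sphere, Finset.mem_filter, Finset.mem_univ, true_and,
        Finset.mem_insert, Finset.mem_singleton]
      omega
    · have := natAbs_valMinAbs_le_torusNorm k j
      simp only [Function.update_of_ne hj, ball, Finset.mem_filter, Finset.mem_univ, true_and,
        Finset.mem_Icc]
      omega
  have hface (i : Fin d) : (Fintype.piFinset (Function.update (fun _ => ball) i sphere)).card ≤
      2 * (2 * m + 1) ^ (d - 1) := by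
    rw [Fintype.card_piFinset, ← Finset.mul_prod_erase _ _ (Finset.mem_univ i),
      Function.update_self]
    refine Nat.mul_le_mul hsphere
      ((Finset.prod_le_pow_card _ _ (2 * m + 1) fun j hj => ?_).trans ?_)
    · rwa [Function.update_of_ne (Finset.ne_of_mem_erase hj)]
    · simp
  calc _ ≤ _ := Finset.card_le_card hcover
    _ ≤ ∑ i : Fin d, 2 * (2 * m + 1) ^ (d - 1) :=
        Finset.card_biUnion_le.trans (Finset.sum_le_sum fun i _ => hface i)
    _ = _ := by simp

lemma sum_torusNorm_eq_one_div_pow_le {p m : ℕ} (hp : p < d) (hm : m ≠ 0) :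
    ∑ k : Vertex d n with k ≠ 0 ∧ torusNorm k = m, 1 / (torusNorm k : ℝ) ^ p ≤
      2 * d * 3 ^ (d - 1) * (m : ℝ) ^ (d - 1 - p) := by
  have : (0 : ℝ) < m := Nat.cast_pos.2 (Nat.pos_of_ne_zero hm)
  have hthree : 2 * (m : ℝ) + 1 ≤ 3 * m := by
    linarith [(Nat.one_le_cast (α := ℝ)).2 (Nat.pos_of_ne_zero hm)]
  have hpow : (m : ℝ) ^ (d - 1) = m ^ (d - 1 - p) * m ^ p := by
    rw [← pow_add, Nat.sub_add_cancel (by omega)]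
  calc ∑ k : Vertex d n with k ≠ 0 ∧ torusNorm k = m, 1 / (torusNorm k : ℝ) ^ p
      = (Finset.univ.filter fun k : Vertex d n => k ≠ 0 ∧ torusNorm k = m).card *
          (1 / (m : ℝ) ^ p) := by
        rw [← nsmul_eq_mul]
        exact Finset.sum_eq_card_nsmul fun k hk => by rw [(Finset.mem_filter.1 hk).2.2]
    _ ≤ (d * (2 * (2 * m + 1) ^ (d - 1))) * (1 / (m : ℝ) ^ p) := by
        gcongr
        exact_mod_cast card_torusNorm_eq_le m
    _ ≤ (d * (2 * (3 * m) ^ (d - 1))) * (1 / (m : ℝ) ^ p) := by gcongr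
    _ = 2 * d * 3 ^ (d - 1) * (m : ℝ) ^ (d - 1 - p) := by
        rw [mul_pow, hpow]
        field_simp

lemma sum_one_div_torusNorm_pow_le {p : ℕ} (hp : p < d) :
    ∑ k : Vertex d n with k ≠ 0, 1 / (torusNorm k : ℝ) ^ p ≤
      d * 3 ^ (d - 1) * (n : ℝ) ^ (d - p) := by
  have hmaps : ∀ k ∈ Finset.univ.filter (fun k : Vertex d n => k ≠ 0),
      torusNorm k ∈ Finset.Icc 1 (n / 2) := fun k hk =>
    Finset.mem_Icc.2 ⟨torusNorm_pos (Finset.mem_filter.1 hk).2, torusNorm_le_half k⟩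
  have hlayer : ∀ m ∈ Finset.Icc 1 (n / 2),
      ∑ k : Vertex d n with k ≠ 0 ∧ torusNorm k = m, 1 / (torusNorm k : ℝ) ^ p ≤
        2 * d * 3 ^ (d - 1) * (n : ℝ) ^ (d - 1 - p) := fun m hm => by
    obtain ⟨hm₁, hmn⟩ := Finset.mem_Icc.1 hm
    refine (sum_torusNorm_eq_one_div_pow_le hp (by omega)).trans ?_
    gcongr
    omega
  calc ∑ k : Vertex d n with k ≠ 0, 1 / (torusNorm k : ℝ) ^ p
      = ∑ m ∈ Finset.Icc 1 (n / 2),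
          ∑ k : Vertex d n with k ≠ 0 ∧ torusNorm k = m, 1 / (torusNorm k : ℝ) ^ p := by
        rw [← Finset.sum_fiberwise_of_maps_to hmaps]
        simp only [Finset.filter_filter]
    _ ≤ (n / 2 : ℕ) * (2 * d * 3 ^ (d - 1) * (n : ℝ) ^ (d - 1 - p)) := by
        simpa using Finset.sum_le_card_nsmul _ _ _ hlayer
    _ ≤ (n / 2) * (2 * d * 3 ^ (d - 1) * (n : ℝ) ^ (d - 1 - p)) := by
        gcongr
        exact Nat.cast_div_le
    _ = d * 3 ^ (d - 1) * (n : ℝ) ^ (d - p) := by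
        rw [show d - p = d - 1 - p + 1 by omega, pow_succ (n : ℝ)]
        ring

lemma cos_val_eq_cos_valMinAbs (a : ZMod n) :
    Real.cos (2 * Real.pi * (a.val : ℝ) / n) = Real.cos (2 * Real.pi * (a.valMinAbs : ℝ) / n) := by
  rw [ZMod.valMinAbs_def_pos]
  split_ifs
  · rw [Int.cast_natCast]
  · rw [← Real.cos_sub_two_pi]
    congr 1
    have hn : (n : ℝ) ≠ 0 := NeZero.ne _
    push_cast
    field_simp

lemma le_one_sub_cos_val (a : ZMod n) :
    8 * (a.valMinAbs.natAbs : ℝ) ^ 2 / n ^ 2 ≤ 1 - Real.cos (2 * Real.pi * (a.val : ℝ) / n) := by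
  have hn : (0 : ℝ) < n := Nat.cast_pos.2 (NeZero.pos n)
  have habs : (a.valMinAbs.natAbs : ℝ) = |(a.valMinAbs : ℝ)| := by
    rw [Nat.cast_natAbs, Int.cast_abs]
  have hhalf : (a.valMinAbs.natAbs : ℝ) ≤ n / 2 :=
    (Nat.cast_le.2 a.natAbs_valMinAbs_le).trans Nat.cast_div_le
  have hangle : |2 * Real.pi * (a.valMinAbs : ℝ) / n| ≤ Real.pi := by
    rw [abs_div, abs_mul, abs_of_pos hn, abs_of_pos Real.two_pi_pos, ← habs, div_le_iff₀ hn]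
    nlinarith [Real.pi_pos]
  rw [cos_val_eq_cos_valMinAbs, habs, sq_abs]
  calc 8 * (a.valMinAbs : ℝ) ^ 2 / n ^ 2
      = 2 / Real.pi ^ 2 * (2 * Real.pi * (a.valMinAbs : ℝ) / n) ^ 2 := by
        field_simp
        ring
    _ ≤ _ := by linarith [Real.cos_le_one_sub_mul_cos_sq hangle]

lemma le_one_sub_cos_modeAngle {k : Vertex d n} (hk : k ≠ 0) :
    8 * (torusNorm k : ℝ) ^ 2 / (d * n ^ 2) ≤ 1 - Real.cos (modeAngle k) := by
  obtain ⟨i, hi⟩ := exists_natAbs_valMinAbs_eq_torusNorm hk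
  rw [one_sub_cos_modeAngle i.pos.ne', ← hi, mul_comm (d : ℝ), ← div_div]
  gcongr
  exact (le_one_sub_cos_val (k i)).trans (Finset.single_le_sum
    (f := fun i => 1 - Real.cos (2 * Real.pi * ((k i).val : ℝ) / n))
    (fun i _ => sub_nonneg.2 (Real.cos_le_one _)) (Finset.mem_univ i))

lemma one_sub_cos_modeAngle_pos {k : Vertex d n} (hk : k ≠ 0) :
    0 < 1 - Real.cos (modeAngle k) := by
  obtain ⟨i, -⟩ := Function.ne_iff.1 hk
  have hd : (0 : ℝ) < d := Nat.cast_pos.2 i.pos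
  have hn : (0 : ℝ) < n := Nat.cast_pos.2 (NeZero.pos n)
  have hk₀ : (0 : ℝ) < torusNorm k := Nat.cast_pos.2 (torusNorm_pos hk)
  exact (by positivity : (0 : ℝ) < _).trans_le (le_one_sub_cos_modeAngle hk)

lemma hasDirichletGap_transition_flipFlop {b : ℝ} (hb : 0 < b)
    (hsum : ∑ k : Vertex d n with k ≠ 0, 1 / (1 - Real.cos (modeAngle k)) ≤ b * (n : ℝ) ^ d) :
    HasDirichletGap (transition (flipFlop : Label d n → Label d n)) 0
      (1 / (2 * b * Fintype.card (Vertex d n))) := by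
  rw [card_vertex, mul_assoc]
  exact hasDirichletGap_of_dft (isPrimitive_piChar (ZMod.isPrimitive_stdAddChar n))
    dft_transition_flipFlop (Real.cos_le_one _)
    (fun k hk => sub_pos.1 (one_sub_cos_modeAngle_pos hk))
    (mul_pos hb (pow_pos (Nat.cast_pos.2 (NeZero.pos n)) d)) hsum

lemma sum_one_div_one_sub_cos_modeAngle_le (hd : 2 < d) :
    ∑ k : Vertex d n with k ≠ 0, 1 / (1 - Real.cos (modeAngle k)) ≤
      d ^ 2 * 3 ^ (d - 1) / 8 * (n : ℝ) ^ d := by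
  have hterm : ∀ k ∈ Finset.univ.filter (fun k : Vertex d n => k ≠ 0),
      1 / (1 - Real.cos (modeAngle k)) ≤ d * n ^ 2 / 8 * (1 / (torusNorm k : ℝ) ^ 2) := by
    intro k hk
    have hk₀ := (Finset.mem_filter.1 hk).2
    have hnorm : (0 : ℝ) < torusNorm k := Nat.cast_pos.2 (torusNorm_pos hk₀)
    have : (0 : ℝ) < d := Nat.cast_pos.2 (by omega)
    have hn : (0 : ℝ) < n := Nat.cast_pos.2 (NeZero.pos n)
    calc 1 / (1 - Real.cos (modeAngle k)) ≤ 1 / (8 * (torusNorm k : ℝ) ^ 2 / (d * n ^ 2)) :=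
          one_div_le_one_div_of_le (by positivity) (le_one_sub_cos_modeAngle hk₀)
      _ = _ := by field_simp
  calc ∑ k : Vertex d n with k ≠ 0, 1 / (1 - Real.cos (modeAngle k))
      ≤ d * n ^ 2 / 8 * ∑ k : Vertex d n with k ≠ 0, 1 / (torusNorm k : ℝ) ^ 2 := by
        rw [Finset.mul_sum]
        exact Finset.sum_le_sum hterm
    _ ≤ d * n ^ 2 / 8 * (d * 3 ^ (d - 1) * (n : ℝ) ^ (d - 2)) := by
        gcongr
        exact sum_one_div_torusNorm_pow_le hd
    _ = d ^ 2 * 3 ^ (d - 1) / 8 * (n : ℝ) ^ d := by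
        rw [← Nat.sub_add_cancel hd.le, pow_add (n : ℝ), Nat.add_sub_cancel]
        ring

lemma le_sum_one_div_one_sub_cos_modeAngle (hd : d ≠ 0) (hn : 2 ≤ n) :
    1 / 4 * (n : ℝ) ^ d ≤ ∑ k : Vertex d n with k ≠ 0, 1 / (1 - Real.cos (modeAngle k)) := by
  have hterm : ∀ k ∈ Finset.univ.filter (fun k : Vertex d n => k ≠ 0),
      1 / 2 ≤ 1 / (1 - Real.cos (modeAngle k)) := fun k hk =>
    one_div_le_one_div_of_le (one_sub_cos_modeAngle_pos (Finset.mem_filter.1 hk).2)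
      (by linarith [Real.neg_one_le_cos (modeAngle k)])
  have hcard : ((Finset.univ.filter fun k : Vertex d n => k ≠ 0).card : ℝ) = n ^ d - 1 := by
    rw [Finset.filter_ne', Finset.card_erase_of_mem (Finset.mem_univ _), Finset.card_univ,
      Nat.cast_pred Fintype.card_pos, card_vertex]
  have htwo : (2 : ℝ) ≤ n ^ d :=
    calc (2 : ℝ) ≤ n := by exact_mod_cast hn
      _ ≤ n ^ d := le_self_pow₀ (by exact_mod_cast one_le_two.trans hn) hd
  calc 1 / 4 * (n : ℝ) ^ d ≤ (n ^ d - 1) * (1 / 2) := by linarith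
    _ ≤ _ := by
        rw [← hcard, ← nsmul_eq_mul]
        exact Finset.card_nsmul_le_sum _ _ _ hterm

end ModeSum

end GridSearch

theorem theorem4 (d : ℕ) (hd : 3 ≤ d) :
    (∃ C p : ℝ, 0 < C ∧ 0 < p ∧ ∀ (n : ℕ) [NeZero n],
      ∃ T : ℕ, (T : ℝ) ≤ C * √((n : ℝ) ^ d) ∧
        ∀ v : GridSearch.Vertex d n, p ≤ GridSearch.successProb v T) ∧
    (∃ a b : ℝ, 0 < a ∧ 0 < b ∧ ∀ (n : ℕ) [NeZero n], 2 ≤ n →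
      a * (n : ℝ) ^ d ≤
          ∑ k : Fin d → ZMod n with k ≠ 0, 1 / (1 - Real.cos (GridSearch.modeAngle k)) ∧
        ∑ k : Fin d → ZMod n with k ≠ 0, 1 / (1 - Real.cos (GridSearch.modeAngle k)) ≤
          b * (n : ℝ) ^ d) := by
  have : NeZero d := ⟨by omega⟩
  set b : ℝ := (d : ℝ) ^ 2 * 3 ^ (d - 1) / 8
  have hb : 0 < b := by
    have : (0 : ℝ) < d := Nat.cast_pos.2 (NeZero.pos d)
    positivity
  refine ⟨⟨2 * Real.log (3 * (2 * b + 2)), (1 / (3 * (2 * b + 2))) ^ 2,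
    mul_pos two_pos (Real.log_pos (by linarith)), by positivity, fun n _ => ?_⟩,
    1 / 4, b, by norm_num, hb, fun n _ hn =>
      ⟨GridSearch.le_sum_one_div_one_sub_cos_modeAngle (NeZero.ne d) hn,
        GridSearch.sum_one_div_one_sub_cos_modeAngle_le hd⟩⟩
  obtain ⟨T, hT, hprob⟩ := (GridSearch.hasDirichletGap_transition_flipFlop hb
    (GridSearch.sum_one_div_one_sub_cos_modeAngle_le (n := n) hd)).exists_le_hitProb
      (mul_pos two_pos hb) GridSearch.flipFlop_involutive
  refine ⟨T, by rwa [← GridSearch.card_vertex], fun v => ?_⟩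
  rwa [GridSearch.successProb_eq_hitProb_zero]
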